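/- Let $\delta>0$, $\alpha>1$, $v_c\ge 0$ and $T>0$, let $J,N\ge 1$ be integers, and put $h=2\pi/J$ and $k=T/N$. Let $R:[0,T]\to(0,\infty)$ be a solution of $\dfrac{dR}{dt}=v_c+\dfrac{\alpha-1}{R}$. Let $\mathbb{R}^J_{\mathrm{per}}$ be the space of real sequences $V=(V_i)_{i\in\mathbb{Z}}$ with $V_{i+J}=V_i$ for all $i$. For $V,W\in\mathbb{R}^J_{\mathrm{per}}$ and $r>0$ set $$(\Delta_hV)_i=\frac{V_{i-1}-2V_i+V_{i+1}}{h^2},\qquad (\varphi(V,W))_i=(V_{i-1}+V_i+V_{i+1})(W_{i+1}-W_{i-1}),$$ $$(\mathcal{L}_{h,r}V)_i=\frac{\delta}{r^4}(\Delta_h\Delta_hV)_i+\frac1{r^2}\Big(\alpha-1+\frac{\delta}{r^2}\Big)(\Delta_hV)_i+\frac{\alpha-1}{r^2}V_i .$$ For $0\le n\le N-1$ write $R_{n+1/2}=R\big((n+\tfrac12)k\big)$, and consider the Crank–Nicolson system for $V^n,V^{n+1}\in\mathbb{R}^J_{\mathrm{per}}$, with $V^{n+1/2}=\tfrac12(V^n+V^{n+1})$: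 $$\frac{V^{n+1}_i-V^n_i}{k}+\big(\mathcal{L}_{h,R_{n+1/2}}V^{n+1/2}\big)_i=\frac{v_c}{6hR_{n+1/2}^2}\big(\varphi(V^{n+1/2},V^{n+1/2})\big)_i,\qquad i=1,\dots,J.\tag{CN}$$ Assume that $$R(0)>\sqrt{\frac{\delta}{\alpha-1}}\qquad\text{and}\qquad k<\frac{8\delta}{\Big(\alpha-1-\dfrac{\delta}{R(T)^2}\Big)^2}.$$ Then (CN) has a solution at every time step: for every $n\in\{0,\dots,N-1\}$ and every $V^n\in\mathbb{R}^J_{\mathrm{per}}$ there is $V^{n+1}\in\mathbb{R}^J_{\mathrm{per}}$ satisfying (CN). Moreover, for every initial vector $V^0\in\mathbb{R}^J_{\mathrm{per}}$ there are $V^1,\dots,V^N\in\mathbb{R}^J_{\mathrm{per}}$ such that (CN) holds for all $n=0,\dots,N-1$ and such that, if $h\sum_{i=1}^JV^0_i=0$, then $h\sum_{i=1}^JV^n_i=0$ for all $0\le n\le N$. -/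

import Mathlib

namespace ExpandingKS

/-- The space `ℝ^J_per` of real sequences `(V_i)_{i ∈ ℤ}` with `V_{i+J} = V_i`. -/
def PerSeq (J : ℕ) : Submodule ℝ (ℤ → ℝ) where
  carrier := {V | ∀ i : ℤ, V (i + J) = V i}
  add_mem' := by
    intro V W hV hW i
    simp only [Pi.add_apply, hV i, hW i]
  zero_mem' := by
    intro i
    rfl
  smul_mem' := by
    intro c V hV i
    simp only [Pi.smul_apply, hV i]

/-- The mesh size `h = 2π / J`. -/
noncomputable def meshSize (J : ℕ) : ℝ := 2 * Real.pi / J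

/-- The time increment `k = T / N`. -/
noncomputable def timeStep (T : ℝ) (N : ℕ) : ℝ := T / N

/-- `R` is the radius of an expanding circle solution on `[0, T]`: it is positive and solves
`dR/dt = v_c + (α - 1) / R` (with one-sided derivatives at the end points). -/
def IsCircleRadius (α vc T : ℝ) (R : ℝ → ℝ) : Prop :=
  ∀ t ∈ Set.Icc 0 T, 0 < R t ∧
    HasDerivWithinAt R (vc + (α - 1) / R t) (Set.Icc 0 T) t

/-- The second-order central difference `Δ_h V`. -/
noncomputable def discreteLaplacian (h : ℝ) (V : ℤ → ℝ) : ℤ → ℝ :=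
  fun i => 1 / h ^ 2 * (V (i - 1) - 2 * V i + V (i + 1))

/-- The linear difference operator of the scheme, where `r` is the value of the radius. -/
noncomputable def linearOp (δ α h r : ℝ) (V : ℤ → ℝ) : ℤ → ℝ :=
  fun i => δ / r ^ 4 * discreteLaplacian h (discreteLaplacian h V) i
    + 1 / r ^ 2 * (α - 1 + δ / r ^ 2) * discreteLaplacian h V i
    + (α - 1) / r ^ 2 * V i

/-- The bilinear map `φ` of the nonlinear term. -/
def phi (V W : ℤ → ℝ) : ℤ → ℝ :=
  fun i => (V (i - 1) + V i + V (i + 1)) * (W (i + 1) - W (i - 1))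

/-- The average `(U + W) / 2` of two consecutive time levels. -/
noncomputable def midLevel (U W : ℤ → ℝ) : ℤ → ℝ :=
  fun i => 1 / 2 * (U i + W i)

/-- The Crank-Nicolson equations leading from the time level `U = V^n` to `W = V^{n+1}`, with
`J` mesh points and time increment `k`; the radius is taken at the time `(n + 1/2) k`. -/
def CrankNicolsonStep (δ α vc : ℝ) (R : ℝ → ℝ) (J : ℕ) (k : ℝ) (n : ℕ) (U W : ℤ → ℝ) : Prop :=
  ∀ i ∈ Set.Icc (1 : ℤ) (J : ℤ),
    1 / k * (W i - U i)
        + linearOp δ α (meshSize J) (R (((n : ℝ) + 1 / 2) * k)) (midLevel U W) i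
      = vc / (6 * meshSize J * R (((n : ℝ) + 1 / 2) * k) ^ 2)
        * phi (midLevel U W) (midLevel U W) i

/-- The discrete zero average condition `h ∑_{i=1}^J V_i = 0`. -/
def ZeroAverage (J : ℕ) (V : ℤ → ℝ) : Prop :=
  ∑ i ∈ Finset.Icc (1 : ℤ) (J : ℤ), meshSize J * V i = 0

end ExpandingKS

/-!
The Crank–Nicolson step is solved for the midpoint `X = (V^n + V^{n+1}) / 2`, which has to be a zero
of `G(X) = (2 / k) (X - V^n) + L X - c φ(X, X)`. The nonlinear term satisfies `∑ φ(X, X) X = 0`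
(`ExpandingKS.sum_phi_self_mul_self`), and completing the square in the quadratic form of `L` gives
`∑ (L X) X ≥ -((α - 1 - δ / r²)² / (4 δ)) ∑ X²` (`ExpandingKS.le_sum_linearOp_mul_self`). The
radius is nondecreasing and `R(0)² > δ / (α - 1)`, so `0 < α - 1 - δ / r² ≤ α - 1 - δ / R(T)²`, and
the bound on `k` makes `2 / k` strictly larger than the constant just found. Hence `G` points
outwards on all large spheres, and a consequence of Brouwer's theorem
(`exists_eq_zero_of_inner_pos`) yields a zero.

The topological input is the absence of `C¹` retractions of a ball onto its sphere
(`not_exists_contDiff_retraction`), proved by the argument of Milnor and Rogers: if `f` were one and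
`g = f - id`, then `id + t g` would be a bijection of the ball for small `t`, so that the integral of
its Jacobian, a polynomial in `t`, would be the volume of the ball; but at `t = 1` the Jacobian
vanishes because `f` takes values in a sphere.

Summing the scheme over a period annihilates the differences and `φ(X, X)`, so a zero average is
passed on from each time level to the next (`ExpandingKS.CrankNicolsonStep.zeroAverage`).
-/

open MeasureTheory Metric Set
open scoped NNReal ENNReal RealInnerProductSpace

/-! ### Zeros of outward pointing vector fields -/

section Brouwer

variable {E : Type*} [NormedAddCommGroup E]

/-- Solving `x + t • g x = y` amounts to finding a fixed point of the contraction
`x ↦ y - t • g x`. -/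
theorem bijective_id_add_smul_of_lipschitzWith [NormedSpace ℝ E] [CompleteSpace E]
    {g : E → E} {K : ℝ≥0} (hg : LipschitzWith K g) {t : ℝ} (ht0 : 0 ≤ t) (ht : t * K < 1) :
    Function.Bijective fun x => x + t • g x := by
  have key : ∀ y : E, ContractingWith (t.toNNReal * K) fun x => y - t • g x := by
    intro y
    refine ⟨?_, LipschitzWith.of_dist_le_mul fun a b => ?_⟩
    · rw [← NNReal.coe_lt_coe]
      simpa [ht0] using ht
    · have := hg.dist_le_mul a b
      rw [dist_sub_left, dist_smul₀, Real.norm_of_nonneg ht0, NNReal.coe_mul,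
        Real.coe_toNNReal t ht0, mul_assoc]
      gcongr
  refine ⟨fun a b hab => ?_, fun y => ⟨_, eq_sub_iff_add_eq.1
    (key y).fixedPoint_isFixedPt.symm⟩⟩
  have ha : Function.IsFixedPt (fun x => (a + t • g a) - t • g x) a := by
    simp [Function.IsFixedPt]
  have hb : Function.IsFixedPt (fun x => (a + t • g a) - t • g x) b := by
    simp only [Function.IsFixedPt]
    simp only at hab
    rw [hab, add_sub_cancel_right]
  exact ((key _).fixedPoint_unique ha).trans ((key _).fixedPoint_unique hb).symm

theorem lipschitzWith_of_lipschitzOnWith_closedBall [NormedSpace ℝ E] {g : E → E} {K : ℝ≥0}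
    {ρ : ℝ} (hg : LipschitzOnWith K g (closedBall 0 ρ)) (h0 : ∀ x, ρ ≤ ‖x‖ → g x = 0) :
    LipschitzWith K g := by
  -- a segment that leaves the ball crosses the sphere, where `g` vanishes
  have cross : ∀ x y : E, ‖x‖ ≤ ρ → ρ ≤ ‖y‖ → dist (g x) (g y) ≤ K * dist x y := by
    intro x y hx hy
    have hcont : ContinuousOn (fun s : ℝ => ‖AffineMap.lineMap x y s‖) (Icc 0 1) := by
      have : Continuous fun s : ℝ => AffineMap.lineMap x y s := AffineMap.lineMap_continuous
      exact this.norm.continuousOn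
    obtain ⟨s, hs, hsρ⟩ := intermediate_value_Icc zero_le_one hcont
      (show ρ ∈ Icc _ _ by simpa using ⟨hx, hy⟩)
    simp only at hsρ
    have hz := hg.dist_le_mul x (by simpa using hx) (AffineMap.lineMap x y s)
      (by simpa using hsρ.le)
    rw [h0 _ hsρ.ge] at hz
    rw [h0 y hy]
    refine hz.trans ?_
    rw [dist_left_lineMap, Real.norm_of_nonneg hs.1]
    gcongr
    exact mul_le_of_le_one_left dist_nonneg hs.2
  refine LipschitzWith.of_dist_le_mul fun x y => ?_
  rcases le_total ‖x‖ ρ with hx | hx <;> rcases le_total ‖y‖ ρ with hy | hy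
  · exact hg.dist_le_mul x (by simpa using hx) y (by simpa using hy)
  · exact cross x y hx hy
  · rw [dist_comm, dist_comm x]
    exact cross y x hy hx
  · rw [h0 x hx, h0 y hy, dist_self]
    positivity

theorem exists_polynomial_det_one_add_smul {V : Type*} [AddCommGroup V] [Module ℝ V]
    [FiniteDimensional ℝ V] (A : V →ₗ[ℝ] V) :
    ∃ p : Polynomial ℝ, p.natDegree ≤ Module.finrank ℝ V ∧
      ∀ t : ℝ, p.eval t = LinearMap.det (LinearMap.id + t • A) := by
  classical
  let b := Module.finBasis ℝ V
  let M := LinearMap.toMatrix b b A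
  refine ⟨_, (Polynomial.natDegree_det_X_add_C_le M 1).trans (by simp), fun t => ?_⟩
  rw [← LinearMap.det_toMatrix b, ← Polynomial.coe_evalRingHom, RingHom.map_det]
  congr 1
  rw [map_add, map_add, LinearMap.toMatrix_id, map_smul (LinearMap.toMatrix b b), add_comm]
  ext i j
  simp [M, Matrix.one_apply, mul_comm t]

/-- Since `t ↦ det (1 + t A)` is a polynomial of degree at most `dim V`, its value at `t = 1` is
recovered by Lagrange interpolation from nodes that are arbitrarily close to `0`. The weights do not
depend on `A`, so the formula can be integrated when `A` varies with a point. -/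
theorem exists_weights_det_one_add (V : Type*) [AddCommGroup V] [Module ℝ V]
    [FiniteDimensional ℝ V] {ε : ℝ} (hε : 0 < ε) :
    ∃ (s : Finset ℕ) (τ c : ℕ → ℝ), (∀ i, 0 < τ i ∧ τ i < ε) ∧ ∑ i ∈ s, c i = 1 ∧
      ∀ A : V →ₗ[ℝ] V, LinearMap.det (LinearMap.id + A)
        = ∑ i ∈ s, c i * LinearMap.det (LinearMap.id + τ i • A) := by
  -- the shift by `2` keeps every node strictly below `ε`
  let τ : ℕ → ℝ := fun i => ε / (i + 2)
  let s := Finset.range (Module.finrank ℝ V + 1)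
  have hinj : InjOn τ s := by
    intro i _ j _ hij
    have hi : (i : ℝ) + 2 ≠ 0 := by positivity
    have hj : (j : ℝ) + 2 ≠ 0 := by positivity
    have : (j : ℝ) + 2 = i + 2 := by
      simpa [τ, div_eq_div_iff hi hj, hε.ne'] using hij
    exact_mod_cast (add_right_cancel this).symm
  refine ⟨s, τ, fun i => (Lagrange.basis s τ i).eval 1, fun i => ?_, ?_, fun A => ?_⟩
  · have : (0 : ℝ) ≤ i := i.cast_nonneg
    exact ⟨by positivity, div_lt_self hε (by linarith)⟩
  · rw [← Polynomial.eval_finsetSum, Lagrange.sum_basis hinj (by simp [s]), Polynomial.eval_one]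
  · obtain ⟨p, hp, hpe⟩ := exists_polynomial_det_one_add_smul A
    have hdeg : p.degree < s.card := by
      refine Polynomial.degree_le_natDegree.trans_lt ?_
      simp only [s, Finset.card_range]
      exact_mod_cast Nat.lt_succ_of_le hp
    have := congrArg (Polynomial.eval 1) (Lagrange.eq_interpolate hinj hdeg)
    rw [hpe, one_smul, Lagrange.interpolate_apply, Polynomial.eval_finsetSum] at this
    rw [this]
    refine Finset.sum_congr rfl fun i _ => ?_
    rw [Polynomial.eval_mul, Polynomial.eval_C, hpe, mul_comm]

/-- The determinant does not vanish on `[0, t]` and equals `1` at `0`. -/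
theorem det_id_add_smul_pos [NormedSpace ℝ E] [FiniteDimensional ℝ E]
    {A : E →L[ℝ] E} {K t : ℝ} (hA : ‖A‖ ≤ K) (ht0 : 0 ≤ t) (ht : t * K < 1) :
    0 < (ContinuousLinearMap.id ℝ E + t • A).det := by
  have hne : ∀ s ∈ Icc 0 t, (ContinuousLinearMap.id ℝ E + s • A).det ≠ 0 := by
    intro s hs h
    obtain ⟨v, hv, hv0⟩ := (Submodule.ne_bot_iff _).1
      (LinearMap.bot_lt_ker_of_det_eq_zero (f := ((ContinuousLinearMap.id ℝ E + s • A :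
        E →L[ℝ] E) : E →ₗ[ℝ] E)) h).ne'
    have hv' : v + s • A v = 0 := by simpa using hv
    have h1 : ‖v‖ = s * ‖A v‖ := by
      rw [← Real.norm_of_nonneg hs.1, ← norm_smul, ← norm_neg (s • A v),
        ← eq_neg_of_add_eq_zero_left hv']
    have h2 : ‖A v‖ ≤ K * ‖v‖ := A.le_of_opNorm_le hA v
    have h3 : 0 < ‖v‖ := norm_pos_iff.2 hv0
    have hK : 0 ≤ K := (norm_nonneg _).trans hA
    have h4 : s * K ≤ t * K := mul_le_mul_of_nonneg_right hs.2 hK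
    nlinarith [mul_le_mul_of_nonneg_left h2 hs.1]
  have hcont : ContinuousOn (fun s : ℝ => (ContinuousLinearMap.id ℝ E + s • A).det)
      (Icc 0 t) :=
    (ContinuousLinearMap.continuous_det.comp (by fun_prop)).continuousOn
  by_contra! hneg
  obtain ⟨s, hs, hs0⟩ := intermediate_value_Icc' ht0 hcont
    (show (0 : ℝ) ∈ Icc _ _ from ⟨hneg, by simp [ContinuousLinearMap.det]⟩)
  exact hne s hs hs0

/-- For small `t` the map `x ↦ x + t • g x` permutes the ball, and its Jacobian is positive there; the
change of variables formula then gives the integral of the Jacobian. -/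
theorem integral_ball_det_eq_volume [NormedSpace ℝ E] [FiniteDimensional ℝ E]
    [MeasurableSpace E] [BorelSpace E] (μ : Measure E) [μ.IsAddHaarMeasure]
    {g : E → E} {g' : E → E →L[ℝ] E} {K : ℝ≥0} {ρ : ℝ}
    (hg : LipschitzWith K g) (h0 : ∀ x, ρ ≤ ‖x‖ → g x = 0)
    (hg' : ∀ x ∈ ball (0 : E) ρ, HasFDerivAt g (g' x) x)
    {t : ℝ} (ht0 : 0 ≤ t) (ht : t * K < 1) :
    ∫ x in ball (0 : E) ρ, (ContinuousLinearMap.id ℝ E + t • g' x).det ∂μ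
      = μ.real (ball (0 : E) ρ) := by
  have : CompleteSpace E := FiniteDimensional.complete ℝ E
  have hbij := bijective_id_add_smul_of_lipschitzWith hg ht0 ht
  have himage : (fun x => x + t • g x) '' ball (0 : E) ρ = ball 0 ρ := by
    -- outside the ball the map is the identity, so it permutes the complement of the ball
    have hcompl : (fun x => x + t • g x) '' (ball (0 : E) ρ)ᶜ = (ball 0 ρ)ᶜ := by
      rw [show (ball (0 : E) ρ)ᶜ = id '' (ball (0 : E) ρ)ᶜ by simp, image_image]
      refine image_congr fun x hx => ?_
      simp [h0 x (by simpa using hx)]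
    rw [image_compl_eq hbij] at hcompl
    exact compl_injective hcompl
  have hder : ∀ x ∈ ball (0 : E) ρ, HasFDerivWithinAt (fun x => x + t • g x)
      (ContinuousLinearMap.id ℝ E + t • g' x) (ball 0 ρ) x := fun x hx =>
    ((hasFDerivAt_id x).add ((hg' x hx).const_smul t)).hasFDerivWithinAt
  have := integral_image_eq_integral_abs_det_fderiv_smul μ measurableSet_ball hder
    hbij.1.injOn (fun _ => (1 : ℝ))
  rw [himage] at this
  simp only [smul_eq_mul, mul_one, integral_const, measureReal_restrict_apply_univ] at this
  rw [this]
  refine setIntegral_congr_fun measurableSet_ball fun x hx => ?_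
  have hn : ‖g' x‖ ≤ K := (hg' x hx).le_of_lipschitz hg
  exact (abs_of_pos (det_id_add_smul_pos hn ht0 ht)).symm

variable [InnerProductSpace ℝ E] [FiniteDimensional ℝ E]

/-- The range of the derivative of a map into a sphere is orthogonal to the value of the map. -/
theorem det_eq_zero_of_norm_eq {f : E → E} {f' : E →L[ℝ] E} {x : E} {ρ : ℝ} (hρ : 0 < ρ)
    (hf' : HasFDerivAt f f' x) (hf : ∀ᶠ y in nhds x, ‖f y‖ = ρ) : f'.det = 0 := by
  by_contra hdet
  have hsq : HasFDerivAt (fun y => ‖f y‖ ^ 2) (0 : E →L[ℝ] ℝ) x :=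
    (hasFDerivAt_const (ρ ^ 2) x).congr_of_eventuallyEq (hf.mono fun y hy => by simp [hy])
  have horth : ∀ v, ⟪f x, f' v⟫ = 0 := by
    intro v
    have := congrArg (fun L : E →L[ℝ] ℝ => L v) (hf'.norm_sq.unique hsq)
    simpa using this
  -- an invertible derivative would reach `f x` itself
  obtain ⟨v, hv⟩ := ((LinearMap.equivOfDetNeZero (f' : E →ₗ[ℝ] E) hdet).surjective) (f x)
  have hv' : f' v = f x := hv
  have := horth v
  rw [hv', inner_self_eq_zero, ← norm_eq_zero, hf.self_of_nhds] at this
  exact hρ.ne' this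

/-- There is no `C¹` retraction of a ball onto its sphere. With `g = f - id`, the integral over the
ball of `det (1 + t g')` is a polynomial in `t` that equals the volume of the ball for small `t`,
whereas it vanishes at `t = 1`. -/
theorem not_exists_contDiff_retraction {f : E → E} (hf : ContDiff ℝ 1 f) {ρ : ℝ} (hρ : 0 < ρ)
    (hball : ∀ x, ‖x‖ < ρ → ‖f x‖ = ρ) (hsphere : ∀ x, ‖x‖ = ρ → f x = x) : False := by
  classical
  let _ : MeasurableSpace E := borel E
  have : BorelSpace E := ⟨rfl⟩
  let μ : Measure E := Measure.addHaar
  -- `f - id`, cut off outside the ball: still Lipschitz, as it vanishes on the sphere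
  let g : E → E := fun x => if ‖x‖ < ρ then f x - x else 0
  have h0 : ∀ x, ρ ≤ ‖x‖ → g x = 0 := fun x hx => if_neg hx.not_gt
  have hgon : EqOn g (fun x => f x - x) (closedBall 0 ρ) := by
    intro x hx
    rcases (mem_closedBall_zero_iff.1 hx).lt_or_eq with h | h
    · simp [g, h]
    · simp [g, h, hsphere x h]
  have hfid : ContDiff ℝ 1 fun x => f x - x := hf.sub contDiff_id
  obtain ⟨K, hK⟩ := hfid.contDiffOn.exists_lipschitzOnWith one_ne_zero
    (convex_closedBall (0 : E) ρ) (isCompact_closedBall 0 ρ)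
  have hg : LipschitzWith K g :=
    lipschitzWith_of_lipschitzOnWith_closedBall
      (fun x hx y hy => by rw [hgon hx, hgon hy]; exact hK hx hy) h0
  let g' : E → E →L[ℝ] E := fderiv ℝ fun x => f x - x
  have hg'cont : Continuous g' := hfid.continuous_fderiv one_ne_zero
  have hg' : ∀ x ∈ ball (0 : E) ρ, HasFDerivAt g (g' x) x := fun x hx =>
    ((hfid.differentiable one_ne_zero x).hasFDerivAt).congr_of_eventuallyEq
      ((hgon.mono ball_subset_closedBall).eventuallyEq_of_mem (isOpen_ball.mem_nhds hx))
  have hdet0 : ∀ x ∈ ball (0 : E) ρ, (ContinuousLinearMap.id ℝ E + g' x).det = 0 := by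
    intro x hx
    refine det_eq_zero_of_norm_eq (f := f) hρ ?_
      (Filter.mem_of_superset (isOpen_ball.mem_nhds hx) fun y hy =>
        hball y (by simpa using hy))
    have := (hasFDerivAt_id x).add (hfid.differentiable one_ne_zero x).hasFDerivAt
    exact this.congr_of_eventuallyEq (.of_forall fun y => by simp)
  obtain ⟨s, τ, c, hτ, hc, hdet⟩ :=
    exists_weights_det_one_add E (ε := 1 / (K + 1)) (by positivity)
  have hτK : ∀ i, τ i * K < 1 := by
    intro i
    have hK0 : (0 : ℝ) ≤ K := K.2
    have := (lt_div_iff₀ (by positivity)).1 (hτ i).2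
    nlinarith [(hτ i).1]
  have hint : ∀ i, IntegrableOn
      (fun x => (ContinuousLinearMap.id ℝ E + τ i • g' x).det) (ball (0 : E) ρ) μ := by
    intro i
    have hcont : Continuous fun x => (ContinuousLinearMap.id ℝ E + τ i • g' x).det :=
      ContinuousLinearMap.continuous_det.comp (by fun_prop)
    exact (hcont.continuousOn.integrableOn_compact (isCompact_closedBall 0 ρ)).mono_set
      ball_subset_closedBall
  have hzero : (0 : ℝ) = ∑ i ∈ s, c i * μ.real (ball (0 : E) ρ) := by
    calc (0 : ℝ) = ∫ x in ball (0 : E) ρ,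
          ∑ i ∈ s, c i * (ContinuousLinearMap.id ℝ E + τ i • g' x).det ∂μ := by
          rw [← integral_zero E ℝ (μ := μ.restrict (ball 0 ρ))]
          refine setIntegral_congr_fun measurableSet_ball fun x hx => ?_
          exact (hdet0 x hx).symm.trans (hdet (g' x))
      _ = ∑ i ∈ s, c i * μ.real (ball (0 : E) ρ) := by
          rw [integral_finsetSum _ fun i _ => (hint i).const_mul (c i)]
          refine Finset.sum_congr rfl fun i _ => ?_
          rw [integral_const_mul, integral_ball_det_eq_volume μ hg h0 hg' (hτ i).1.le (hτK i)]
  rw [← Finset.sum_mul, hc, one_mul] at hzero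
  exact (ENNReal.toReal_pos (measure_ball_pos μ 0 hρ).ne' measure_ball_lt_top.ne).ne hzero

/-- A `C¹` vector field that points outwards outside a ball has a zero. Otherwise, deform it into the
identity far away; normalizing the result gives a retraction of a ball onto its sphere. -/
theorem exists_eq_zero_of_inner_pos {F : E → E} (hF : ContDiff ℝ 1 F) {ρ : ℝ} (hρ : 0 < ρ)
    (hpos : ∀ x, ρ ≤ ‖x‖ → 0 < ⟪F x, x⟫) : ∃ x, F x = 0 := by
  by_contra! hne
  -- `G` agrees with `F` where `F` might not point outwards, and with the identity far away
  let χ : ContDiffBump (0 : E) := ⟨ρ, 2 * ρ, hρ, by linarith⟩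
  let G : E → E := fun x => χ x • F x + (1 - χ x) • x
  have hGne : ∀ x, G x ≠ 0 := by
    intro x hx
    rcases le_total ‖x‖ ρ with h | h
    · have : χ x = 1 := χ.one_of_mem_closedBall (by simpa [χ] using h)
      exact hne x (by simpa [G, this] using hx)
    · have h1 : ⟪G x, x⟫ = χ x * ⟪F x, x⟫ + (1 - χ x) * ‖x‖ ^ 2 := by
        simp [G, inner_add_left, real_inner_smul_left]
      rw [hx, inner_zero_left] at h1
      have h2 := hpos x h
      have h3 : 0 < ‖x‖ ^ 2 := pow_pos (hρ.trans_le h) 2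
      rcases (χ.nonneg (x := x)).eq_or_lt with h4 | h4
      · rw [← h4] at h1
        linarith
      · have := mul_pos h4 h2
        have := mul_nonneg (sub_nonneg.2 (χ.le_one (x := x))) h3.le
        linarith
  have hχ : ContDiff ℝ 1 χ := χ.contDiff
  have hG : ContDiff ℝ 1 G := (hχ.smul hF).add ((contDiff_const.sub hχ).smul contDiff_id)
  refine not_exists_contDiff_retraction (f := fun x => (2 * ρ / ‖G x‖) • G x) (ρ := 2 * ρ)
    ((contDiff_const.div (hG.norm ℝ hGne) fun x => norm_ne_zero_iff.2 (hGne x)).smul hG)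
    (by linarith) (fun x _ => ?_) fun x hx => ?_
  · have := norm_pos_iff.2 (hGne x)
    rw [norm_smul, Real.norm_of_nonneg (by positivity)]
    field_simp
  · have : χ x = 0 := χ.zero_of_le_dist (by simpa [χ] using hx.ge)
    have hGx : G x = x := by simp [G, this]
    have h2 : 2 * ρ ≠ 0 := by positivity
    simp only [hGx, hx, div_self h2, one_smul]

end Brouwer

namespace ExpandingKS

/-! ### Sums of periodic sequences over a period -/

theorem PerSeq.shift {J : ℕ} {V : ℤ → ℝ} (hV : V ∈ PerSeq J) (a i : ℤ) :
    V (i + J + a) = V (i + a) := by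
  rw [add_right_comm]
  exact hV _

theorem PerSeq.shift_sub {J : ℕ} {V : ℤ → ℝ} (hV : V ∈ PerSeq J) (a i : ℤ) :
    V (i + J - a) = V (i - a) := by
  rw [add_sub_right_comm]
  exact hV _

theorem discreteLaplacian_mem_perSeq {J : ℕ} {V : ℤ → ℝ} (hV : V ∈ PerSeq J) (h : ℝ) :
    discreteLaplacian h V ∈ PerSeq J := fun i => by
  simp only [discreteLaplacian, hV i, PerSeq.shift hV, PerSeq.shift_sub hV]

theorem linearOp_mem_perSeq {J : ℕ} {V : ℤ → ℝ} (hV : V ∈ PerSeq J) (δ α h r : ℝ) :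
    linearOp δ α h r V ∈ PerSeq J := fun i => by
  simp only [linearOp, hV i, discreteLaplacian_mem_perSeq hV h i,
    discreteLaplacian_mem_perSeq (discreteLaplacian_mem_perSeq hV h) h i]

theorem phi_mem_perSeq {J : ℕ} {V W : ℤ → ℝ} (hV : V ∈ PerSeq J) (hW : W ∈ PerSeq J) :
    phi V W ∈ PerSeq J := fun i => by
  simp only [phi, hV i, PerSeq.shift hV, PerSeq.shift_sub hV, PerSeq.shift hW,
    PerSeq.shift_sub hW]

/-- Every summation by parts below consists in exhibiting a periodic discrete primitive. -/
theorem sum_period_eq_zero_of_telescope {J : ℕ} {f W : ℤ → ℝ} (hW : W ∈ PerSeq J)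
    (hf : ∀ i, f i = W (i + 1) - W i) : ∑ i ∈ Finset.Icc (1 : ℤ) J, f i = 0 := by
  have key : ∀ n : ℕ, ∑ i ∈ Finset.Icc (1 : ℤ) n, f i = W (n + 1) - W 1 := by
    intro n
    induction n with
    | zero => simp
    | succ n ih =>
      rw [Nat.cast_succ, ← Finset.insert_Icc_right_eq_Icc_add_one (by lia),
        Finset.sum_insert (by simp), ih, hf]
      ring
  rw [key, add_comm, hW, sub_self]

theorem sum_discreteLaplacian {J : ℕ} {V : ℤ → ℝ} (hV : V ∈ PerSeq J) (h : ℝ) :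
    ∑ i ∈ Finset.Icc (1 : ℤ) J, discreteLaplacian h V i = 0 :=
  sum_period_eq_zero_of_telescope (W := fun i => 1 / h ^ 2 * (V i - V (i - 1)))
    (fun i => by simp only [hV i, PerSeq.shift_sub hV])
    fun i => by simp only [discreteLaplacian, add_sub_cancel_right]; ring

theorem sum_phi_self {J : ℕ} {V : ℤ → ℝ} (hV : V ∈ PerSeq J) :
    ∑ i ∈ Finset.Icc (1 : ℤ) J, phi V V i = 0 :=
  sum_period_eq_zero_of_telescope
    (W := fun i => V i ^ 2 + V (i - 1) ^ 2 + V i * V (i - 1))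
    (fun i => by simp only [hV i, PerSeq.shift_sub hV])
    fun i => by simp only [phi, add_sub_cancel_right]; ring

/-- The nonlinear term does no work: it is orthogonal to its argument. -/
theorem sum_phi_self_mul_self {J : ℕ} {V : ℤ → ℝ} (hV : V ∈ PerSeq J) :
    ∑ i ∈ Finset.Icc (1 : ℤ) J, phi V V i * V i = 0 :=
  sum_period_eq_zero_of_telescope
    (W := fun i => V (i - 1) * V i ^ 2 + V (i - 1) ^ 2 * V i)
    (fun i => by simp only [hV i, PerSeq.shift_sub hV])
    fun i => by simp only [phi, add_sub_cancel_right]; ring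

theorem sum_discreteLaplacian_mul {J : ℕ} {V W : ℤ → ℝ} (hV : V ∈ PerSeq J)
    (hW : W ∈ PerSeq J) (h : ℝ) :
    ∑ i ∈ Finset.Icc (1 : ℤ) J, discreteLaplacian h V i * W i
      = ∑ i ∈ Finset.Icc (1 : ℤ) J, V i * discreteLaplacian h W i := by
  rw [← sub_eq_zero, ← Finset.sum_sub_distrib]
  exact sum_period_eq_zero_of_telescope
    (W := fun i => 1 / h ^ 2 * (V i * W (i - 1) - V (i - 1) * W i))
    (fun i => by simp only [hV i, hW i, PerSeq.shift_sub hV, PerSeq.shift_sub hW])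
    fun i => by simp only [discreteLaplacian, add_sub_cancel_right]; ring

theorem sum_linearOp {J : ℕ} {V : ℤ → ℝ} (hV : V ∈ PerSeq J) (δ α h r : ℝ) :
    ∑ i ∈ Finset.Icc (1 : ℤ) J, linearOp δ α h r V i
      = (α - 1) / r ^ 2 * ∑ i ∈ Finset.Icc (1 : ℤ) J, V i := by
  simp only [linearOp, Finset.sum_add_distrib, ← Finset.mul_sum, sum_discreteLaplacian hV,
    sum_discreteLaplacian (discreteLaplacian_mem_perSeq hV h), mul_zero, zero_add]

/-- Lower bound for the quadratic form of the linear operator, by summation by parts in the fourth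
order term and completion of the square in `Δ_h V`. -/
theorem le_sum_linearOp_mul_self {J : ℕ} {V : ℤ → ℝ} (hV : V ∈ PerSeq J) {δ : ℝ} (hδ : 0 < δ)
    (α h : ℝ) {r : ℝ} (hr : r ≠ 0) :
    -((α - 1 - δ / r ^ 2) ^ 2 / (4 * δ)) * ∑ i ∈ Finset.Icc (1 : ℤ) J, V i ^ 2
      ≤ ∑ i ∈ Finset.Icc (1 : ℤ) J, linearOp δ α h r V i * V i := by
  have hD := discreteLaplacian_mem_perSeq hV h
  have hparts := sum_discreteLaplacian_mul hD hV h
  have hsq : ∑ i ∈ Finset.Icc (1 : ℤ) J, linearOp δ α h r V i * V i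
      = δ / r ^ 4 * ∑ i ∈ Finset.Icc (1 : ℤ) J,
          (discreteLaplacian h (discreteLaplacian h V) i * V i
            - discreteLaplacian h V i * discreteLaplacian h V i)
        + ∑ i ∈ Finset.Icc (1 : ℤ) J, (δ * (discreteLaplacian h V i / r ^ 2
            + (α - 1 + δ / r ^ 2) / (2 * δ) * V i) ^ 2
            + -((α - 1 - δ / r ^ 2) ^ 2 / (4 * δ)) * V i ^ 2) := by
    rw [Finset.mul_sum, ← Finset.sum_add_distrib]
    refine Finset.sum_congr rfl fun i _ => ?_
    simp only [linearOp]
    field_simp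
    ring
  rw [hsq, Finset.sum_sub_distrib, hparts, sub_self, mul_zero, zero_add, Finset.mul_sum]
  refine Finset.sum_le_sum fun i _ => ?_
  have : 0 ≤ δ * (discreteLaplacian h V i / r ^ 2
            + (α - 1 + δ / r ^ 2) / (2 * δ) * V i) ^ 2 := by positivity
  linarith

/-! ### Periodic sequences and residue classes -/

/-- The periodic sequence given by its values on the residue classes modulo `J`. -/
def ofResidues {J : ℕ} (x : ZMod J → ℝ) : ℤ → ℝ := fun i => x i

theorem ofResidues_mem_perSeq {J : ℕ} (x : ZMod J → ℝ) : ofResidues x ∈ PerSeq J := fun i => by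
  simp [ofResidues]

theorem PerSeq.apply_cast {J : ℕ} {V : ℤ → ℝ} (hV : V ∈ PerSeq J) (i : ℤ) :
    V ((i : ZMod J).cast : ℤ) = V i := by
  have hper : Function.Periodic V (J : ℤ) := hV
  rw [ZMod.coe_intCast, Int.emod_def, mul_comm, ← smul_eq_mul, hper.sub_zsmul_eq]

theorem sum_ofResidues {J : ℕ} [NeZero J] (g : ZMod J → ℝ) :
    ∑ i ∈ Finset.Icc (1 : ℤ) J, ofResidues g i = ∑ j, g j := by
  have hinj : Set.InjOn (fun i : ℤ => (i : ZMod J)) (Finset.Icc (1 : ℤ) J) := by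
    intro a ha b hb hab
    simp only [Finset.coe_Icc, Set.mem_Icc] at ha hb
    have := (ZMod.intCast_eq_intCast_iff_dvd_sub a b J).1 hab
    have := Int.eq_zero_of_abs_lt_dvd this (abs_lt.2 ⟨by lia, by lia⟩)
    lia
  have himg : (Finset.Icc (1 : ℤ) J).image (fun i : ℤ => (i : ZMod J)) = Finset.univ := by
    rw [← Finset.card_eq_iff_eq_univ, Finset.card_image_of_injOn hinj, ZMod.card]
    simp
  rw [← himg, Finset.sum_image hinj]
  rfl

/-! ### Solvability of the scheme and conservation of zero average -/

/-- The Crank–Nicolson system in terms of the midpoint `X = (V^n + V^{n+1}) / 2`. The residual, viewed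
as a vector field on `EuclideanSpace ℝ (ZMod J)`, has inner product with `X` at least
`m ‖X‖² - (2 / k) ⟪U, X⟫`, where `m > 0` by the restriction on `k`. -/
theorem exists_midpoint {J : ℕ} [NeZero J] {δ α k r : ℝ} (hδ : 0 < δ) (hr : r ≠ 0) (hk : 0 < k)
    (hkr : k * (α - 1 - δ / r ^ 2) ^ 2 < 8 * δ) (h c : ℝ) {U : ℤ → ℝ} (hU : U ∈ PerSeq J) :
    ∃ X ∈ PerSeq J, ∀ i, 2 / k * (X i - U i) + linearOp δ α h r X i = c * phi X X i := by
  let Φ : (ℤ → ℝ) → ℤ → ℝ := fun X i =>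
    2 / k * (X i - U i) + linearOp δ α h r X i - c * phi X X i
  have hΦ : ∀ {X}, X ∈ PerSeq J → Φ X ∈ PerSeq J := fun {X} hX i => by
    simp only [Φ, hX i, hU i, linearOp_mem_perSeq hX δ α h r i, phi_mem_perSeq hX hX i]
  let F : EuclideanSpace ℝ (ZMod J) → EuclideanSpace ℝ (ZMod J) := fun x =>
    WithLp.toLp 2 fun j => Φ (ofResidues x) j.cast
  have hFΦ : ∀ x i, F x ((i : ℤ) : ZMod J) = Φ (ofResidues x) i := fun x i =>
    PerSeq.apply_cast (hΦ (ofResidues_mem_perSeq x)) i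
  let u : EuclideanSpace ℝ (ZMod J) := WithLp.toLp 2 fun j => U j.cast
  have hu : ∀ i : ℤ, u (i : ZMod J) = U i := fun i => PerSeq.apply_cast hU i
  have hinner : ∀ x y : EuclideanSpace ℝ (ZMod J),
      ⟪x, y⟫ = ∑ i ∈ Finset.Icc (1 : ℤ) J, ofResidues x i * ofResidues y i := by
    intro x y
    rw [PiLp.inner_apply, ← sum_ofResidues]
    exact Finset.sum_congr rfl fun i _ => mul_comm _ _
  have hF : ContDiff ℝ 1 F := by
    rw [contDiff_euclidean]
    intro j
    simp only [F, Φ, linearOp, discreteLaplacian, phi, ofResidues]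
    fun_prop
  set m : ℝ := 2 / k - (α - 1 - δ / r ^ 2) ^ 2 / (4 * δ) with hm
  have hm0 : 0 < m := by
    rw [hm, sub_pos, div_lt_div_iff₀ (by positivity) hk]
    linarith
  have hcoer : ∀ x, m * ‖x‖ ^ 2 - 2 / k * ⟪u, x⟫ ≤ ⟪F x, x⟫ := by
    intro x
    have hX := ofResidues_mem_perSeq (x : ZMod J → ℝ)
    have hsum : ⟪F x, x⟫ = 2 / k * ‖x‖ ^ 2 - 2 / k * ⟪u, x⟫
        + ∑ i ∈ Finset.Icc (1 : ℤ) J, linearOp δ α h r (ofResidues x) i * ofResidues x i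
        - c * ∑ i ∈ Finset.Icc (1 : ℤ) J,
            phi (ofResidues x) (ofResidues x) i * ofResidues x i := by
      rw [← real_inner_self_eq_norm_sq, hinner, hinner, hinner]
      simp only [Finset.mul_sum, ← Finset.sum_add_distrib, ← Finset.sum_sub_distrib]
      refine Finset.sum_congr rfl fun i _ => ?_
      rw [show ofResidues (F x) i = Φ (ofResidues x) i from hFΦ x i,
        show ofResidues u i = U i from hu i]
      simp only [Φ]
      ring
    have hL := le_sum_linearOp_mul_self hX hδ α h hr
    have hnorm : ‖x‖ ^ 2 = ∑ i ∈ Finset.Icc (1 : ℤ) J, ofResidues x i ^ 2 := by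
      rw [← real_inner_self_eq_norm_sq, hinner]
      simp only [sq]
    rw [sum_phi_self_mul_self hX, mul_zero, sub_zero] at hsum
    rw [← hnorm] at hL
    rw [hsum, hm]
    linarith
  obtain ⟨x, hx⟩ := exists_eq_zero_of_inner_pos hF (ρ := 2 / k * ‖u‖ / m + 1) (by positivity)
    fun x hx => by
      have hux := real_inner_le_norm u x
      have hx0 : 0 < ‖x‖ := lt_of_lt_of_le (by positivity) hx
      have h1 : 2 / k * ‖u‖ < m * ‖x‖ := by
        rw [← div_lt_iff₀' hm0]
        linarith
      have h2 := mul_lt_mul_of_pos_right h1 hx0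
      have h3 := mul_le_mul_of_nonneg_left hux (show 0 ≤ 2 / k by positivity)
      linarith [hcoer x]
  refine ⟨ofResidues x, ofResidues_mem_perSeq _, fun i => ?_⟩
  have := hFΦ x i
  rw [hx] at this
  simp only [PiLp.zero_apply, Φ] at this
  linarith

theorem exists_crankNicolsonStep {J : ℕ} (hJ : 0 < J) {δ α vc k : ℝ} {R : ℝ → ℝ} {n : ℕ}
    (hδ : 0 < δ) (hr : R ((n + 1 / 2) * k) ≠ 0) (hk : 0 < k)
    (hkr : k * (α - 1 - δ / R ((n + 1 / 2) * k) ^ 2) ^ 2 < 8 * δ)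
    {U : ℤ → ℝ} (hU : U ∈ PerSeq J) :
    ∃ W ∈ PerSeq J, CrankNicolsonStep δ α vc R J k n U W := by
  have : NeZero J := ⟨hJ.ne'⟩
  obtain ⟨X, hX, hXeq⟩ := exists_midpoint hδ hr hk hkr (meshSize J)
    (vc / (6 * meshSize J * R ((n + 1 / 2) * k) ^ 2)) hU
  refine ⟨(2 : ℝ) • X - U, sub_mem (Submodule.smul_mem _ _ hX) hU, fun i _ => ?_⟩
  have hmid : midLevel U ((2 : ℝ) • X - U) = X := by
    funext i
    simp [midLevel]
  rw [hmid, ← hXeq i]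
  simp only [Pi.sub_apply, Pi.smul_apply, smul_eq_mul]
  ring

theorem zeroAverage_iff {J : ℕ} (hJ : 0 < J) {V : ℤ → ℝ} :
    ZeroAverage J V ↔ ∑ i ∈ Finset.Icc (1 : ℤ) J, V i = 0 := by
  have : meshSize J ≠ 0 := by
    have : (0 : ℝ) < J := by exact_mod_cast hJ
    unfold meshSize
    positivity
  rw [ZeroAverage, ← Finset.mul_sum, mul_eq_zero, or_iff_right this]

/-- Summing the scheme over a period leaves `(1 / k + (α - 1) / (2 r²)) ∑ W = 0`. -/
theorem CrankNicolsonStep.zeroAverage {J : ℕ} (hJ : 0 < J) {δ α vc k : ℝ} {R : ℝ → ℝ} {n : ℕ}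
    (hα : 1 < α) (hk : 0 < k) {U W : ℤ → ℝ} (hU : U ∈ PerSeq J) (hW : W ∈ PerSeq J)
    (hstep : CrankNicolsonStep δ α vc R J k n U W) (hU0 : ZeroAverage J U) :
    ZeroAverage J W := by
  rw [zeroAverage_iff hJ] at hU0 ⊢
  have hM : midLevel U W ∈ PerSeq J := fun i => by simp only [midLevel, hU i, hW i]
  have hsum := Finset.sum_congr (rfl : Finset.Icc (1 : ℤ) J = _) fun i hi =>
    hstep i (by simpa using hi)
  rw [Finset.sum_add_distrib, ← Finset.mul_sum, ← Finset.mul_sum, sum_linearOp hM,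
    sum_phi_self hM, mul_zero, Finset.sum_sub_distrib, hU0] at hsum
  simp only [midLevel, ← Finset.mul_sum, Finset.sum_add_distrib, hU0] at hsum
  have hpos : 0 < 1 / k + (α - 1) / R ((n + 1 / 2) * k) ^ 2 * (1 / 2) := by
    have : 0 < α - 1 := by linarith
    positivity
  refine (mul_eq_zero.1 ?_).resolve_left hpos.ne'
  linear_combination hsum

theorem IsCircleRadius.monotoneOn {α vc T : ℝ} {R : ℝ → ℝ} (hR : IsCircleRadius α vc T R)
    (hα : 1 < α) (hvc : 0 ≤ vc) : MonotoneOn R (Set.Icc 0 T) := by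
  have hder : ∀ t ∈ interior (Set.Icc 0 T), HasDerivAt R (vc + (α - 1) / R t) t := fun t ht =>
    (hR t (interior_subset ht)).2.hasDerivAt (mem_interior_iff_mem_nhds.1 ht)
  refine monotoneOn_of_deriv_nonneg (convex_Icc 0 T)
    (fun t ht => (hR t ht).2.continuousWithinAt)
    (fun t ht => (hder t ht).differentiableAt.differentiableWithinAt) fun t ht => ?_
  rw [(hder t ht).deriv]
  have := (hR t (interior_subset ht)).1
  have : 0 ≤ α - 1 := by linarith
  positivity

end ExpandingKS

theorem mainTheorem4 (δ α vc T : ℝ) (hδ : 0 < δ) (hα : 1 < α) (hvc : 0 ≤ vc) (hT : 0 < T)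
    (J N : ℕ) (hJ : 0 < J) (hN : 0 < N)
    (R : ℝ → ℝ) (hR : ExpandingKS.IsCircleRadius α vc T R)
    (hR0 : Real.sqrt (δ / (α - 1)) < R 0)
    (hk : ExpandingKS.timeStep T N < 8 * δ / (α - 1 - δ / R T ^ 2) ^ 2) :
    (∀ n < N, ∀ U ∈ ExpandingKS.PerSeq J, ∃ W ∈ ExpandingKS.PerSeq J,
      ExpandingKS.CrankNicolsonStep δ α vc R J (ExpandingKS.timeStep T N) n U W) ∧
    (∀ V₀ ∈ ExpandingKS.PerSeq J, ∃ V : ℕ → ℤ → ℝ,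
      V 0 = V₀ ∧
      (∀ n ≤ N, V n ∈ ExpandingKS.PerSeq J) ∧
      (∀ n < N, ExpandingKS.CrankNicolsonStep δ α vc R J (ExpandingKS.timeStep T N) n
        (V n) (V (n + 1))) ∧
      (ExpandingKS.ZeroAverage J V₀ → ∀ n ≤ N, ExpandingKS.ZeroAverage J (V n))) := by
  have hN' : (0 : ℝ) < N := by exact_mod_cast hN
  have hα' : 0 < α - 1 := by linarith
  have hk0 : 0 < ExpandingKS.timeStep T N := div_pos hT hN'
  have hmono := hR.monotoneOn hα hvc
  have h0T : (0 : ℝ) ∈ Set.Icc 0 T := ⟨le_rfl, hT.le⟩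
  have hTT : T ∈ Set.Icc 0 T := ⟨hT.le, le_rfl⟩
  have hstep : ∀ n < N, ∀ U ∈ ExpandingKS.PerSeq J, ∃ W ∈ ExpandingKS.PerSeq J,
      ExpandingKS.CrankNicolsonStep δ α vc R J (ExpandingKS.timeStep T N) n U W := by
    intro n hn U hU
    have ht : ((n : ℝ) + 1 / 2) * ExpandingKS.timeStep T N ∈ Set.Icc 0 T := by
      refine ⟨by positivity, ?_⟩
      have hn1 : (n : ℝ) + 1 ≤ N := by exact_mod_cast hn
      have hNk : N * ExpandingKS.timeStep T N = T := mul_div_cancel₀ T hN'.ne'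
      calc ((n : ℝ) + 1 / 2) * ExpandingKS.timeStep T N
          ≤ N * ExpandingKS.timeStep T N := by gcongr; linarith
        _ = T := hNk
    have hr0 := (hR _ ht).1
    refine ExpandingKS.exists_crankNicolsonStep hJ hδ hr0.ne' hk0 ?_ hU
    set r := R (((n : ℝ) + 1 / 2) * ExpandingKS.timeStep T N)
    have hrR : R 0 ≤ r := hmono h0T ht ht.1
    have hrT : r ≤ R T := hmono ht hTT ht.2
    -- since `R 0 ^ 2 > δ / (α - 1)`, the bound on `k` is positive and worst at the largest radius
    have hpos : 0 < α - 1 - δ / r ^ 2 := by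
      have hsq : δ / (α - 1) < r ^ 2 := (Real.sqrt_lt' hr0).1 (hR0.trans_le hrR)
      rw [sub_pos, div_lt_iff₀ (by positivity)]
      rwa [div_lt_iff₀' hα'] at hsq
    have hle : α - 1 - δ / r ^ 2 ≤ α - 1 - δ / R T ^ 2 := by gcongr
    have hpT := hpos.trans_le hle
    rw [lt_div_iff₀ (by positivity)] at hk
    refine lt_of_le_of_lt ?_ hk
    gcongr
  refine ⟨hstep, fun V₀ hV₀ => ?_⟩
  choose! next hnext_mem hnext using hstep
  let V : ℕ → ℤ → ℝ := fun n => Nat.rec V₀ (fun n U => next n U) n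
  have hVmem : ∀ n ≤ N, V n ∈ ExpandingKS.PerSeq J := by
    intro n
    induction n with
    | zero => exact fun _ => hV₀
    | succ n ih => exact fun hn => hnext_mem n hn (V n) (ih (Nat.le_of_succ_le hn))
  have hVstep : ∀ n < N, ExpandingKS.CrankNicolsonStep δ α vc R J (ExpandingKS.timeStep T N) n
      (V n) (V (n + 1)) := fun n hn => hnext n hn (V n) (hVmem n hn.le)
  refine ⟨V, rfl, hVmem, hVstep, fun hzero n => ?_⟩
  induction n with
  | zero => exact fun _ => hzero
  | succ n ih =>
    exact fun hn => (hVstep n hn).zeroAverage hJ hα hk0 (hVmem n (Nat.le_of_succ_le hn))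
      (hVmem (n + 1) hn) (ih (Nat.le_of_succ_le hn))
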